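/- An economy consists of a finite set $A$ of agents, a finite set $O$ of (indivisible) objects, and, for each agent $i\in A$, a utility function $v_i:2^O\to\mathbb{R}\cup\{-\infty\}$ and a nonempty endowment $\omega_i\subseteq O$, where the sets $\omega_i$ are pairwise disjoint with union $O$. An allocation is a family $(X_i)_{i\in A}$ of pairwise disjoint subsets of $O$. For a nonempty coalition $S\subseteq A$, an $S$-allocation is a family $(Y_i)_{i\in S}$ of pairwise disjoint sets with $\bigcup_{i\in S}Y_i\subseteq\bigcup_{i\in S}\omega_i$. The coalition $S$ strongly blocks the allocation $X$ if there is an $S$-allocation $Y$ with $v_i(Y_i)>v_i(X_i)$ for all $i\in S$. The weak core is the set of allocations that no nonempty coalition strongly blocks. The economy is categorical if there are finitely many pairwise disjoint sets of objects (categories) $O^1,\dots,O^K\subseteq O$ and, for each agent $i$ and category $k$, a function $v_i^k:O^k\to\{0,1\}$ such that agents consume at most one object of each category and their utilities are dichotomous in each category and additively separable across categories. That is, write $v_i^k(Z)=1$ for $Z\subseteq O^k$ if $v_i^k(o)=1$ for some $o\in Z$, and $v_i^k(Z)=0$ otherwise; then $$v_i(X)=\sum_{k=1}^K v_i^k(X\cap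 O^k)$$ for every $X\subseteq O$ with $|X\cap O^k|\le 1$ for all $k$, while for every other $X\subseteq O$ either the same formula holds (at most one object per category counts) or $v_i(X)=-\infty$ (the bundle cannot be consumed). Theorem. Every categorical economy has a nonempty weak core. -/

import Mathlib

/-- A discrete exchange economy with agents `A` and indivisible objects `O` (both are assumed
finite where the economy is used).  Agent `i` has a utility `v i` over bundles, with values in
`ℝ ∪ {-∞}`, and an endowment `ω i`; the endowments are nonempty and partition the objects. -/
structure Economy (A O : Type*) where
  v : A → Finset O → WithBot ℝ
  ω : A → Finset O
  ω_nonempty : ∀ i, (ω i).Nonempty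
  ω_disjoint : ∀ i j, i ≠ j → Disjoint (ω i) (ω j)
  ω_cover : ∀ o, ∃ i, o ∈ ω i

namespace Economy

/-- An allocation: a pairwise disjoint family of bundles, one for each agent. It need not
exhaust the objects. -/
def IsAllocation {A O : Type*} (_E : Economy A O) (X : A → Finset O) : Prop :=
  ∀ i j, i ≠ j → Disjoint (X i) (X j)

/-- An `S`-allocation: pairwise disjoint bundles for the members of `S`, made of objects that
members of `S` own. (The values of `X` outside `S` play no role.) -/
def IsCoalitionAllocation {A O : Type*} [DecidableEq O] (E : Economy A O) (S : Finset A)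
    (X : A → Finset O) : Prop :=
  (∀ i ∈ S, ∀ j ∈ S, i ≠ j → Disjoint (X i) (X j)) ∧ S.biUnion X ⊆ S.biUnion E.ω

/-- The coalition `S` strongly blocks `X`: some `S`-allocation makes every member of `S`
strictly better off. -/
def StronglyBlocks {A O : Type*} [DecidableEq O] (E : Economy A O) (S : Finset A)
    (X : A → Finset O) : Prop :=
  ∃ Y : A → Finset O, E.IsCoalitionAllocation S Y ∧ ∀ i ∈ S, E.v i (X i) < E.v i (Y i)

/-- The weak core: the allocations that no (nonempty) coalition strongly blocks. -/
def weakCore {A O : Type*} [DecidableEq O] (E : Economy A O) : Set (A → Finset O) :=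
  {X | E.IsAllocation X ∧ ∀ S : Finset A, S.Nonempty → ¬ E.StronglyBlocks S X}

end Economy

open Classical in
/-- The value of a set `Z` of objects of one category, for a utility `w` over single objects of
that category: `1` if some object in `Z` has utility `1`, and `0` otherwise. -/
noncomputable def categoryValue {O : Type*} (w : O → ℝ) (Z : Finset O) : ℝ :=
  if ∃ o ∈ Z, w o = 1 then 1 else 0

/-- A categorical economy: there are `K` disjoint categories `C k` of objects and utilities
`w i k` with values in `{0, 1}` on the objects of category `k`, such that

* a bundle with at most one object of each category is worth the sum over the categories of the
  value of its part in that category;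
* a bundle with more than one object of some category is either worth that same sum (so that at
  most one object per category counts) or not consumable (utility `-∞`).

Objects outside all categories, if any, are worthless. The second clause covers both ways in which an economy can express that an agent consumes at most
one object of each category. -/
def Economy.IsCategorical {A O : Type*} [DecidableEq O] (E : Economy A O) : Prop :=
  ∃ (K : ℕ) (C : Fin K → Finset O) (w : A → Fin K → O → ℝ),
    (∀ k l, k ≠ l → Disjoint (C k) (C l)) ∧
    (∀ i k, ∀ o ∈ C k, w i k o = 0 ∨ w i k o = 1) ∧
    ∀ i X,
      ((∀ k, (X ∩ C k).card ≤ 1) →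
        E.v i X = ((∑ k, categoryValue (w i k) (X ∩ C k) : ℝ) : WithBot ℝ)) ∧
      ((∃ k, 1 < (X ∩ C k).card) →
        E.v i X = ((∑ k, categoryValue (w i k) (X ∩ C k) : ℝ) : WithBot ℝ) ∨ E.v i X = ⊥)

/-! Scarf's lemma, applied to all coalition allocations, yields a family `D` with balancing weights:
the weights of the members containing any given agent sum to one. Moreover every coalition
allocation is ranked, by some agent, no higher than all of `D`. Let `u i` be the utility of agent
`i` in the worst member of `D` that involves `i`. An allocation giving every agent at least `u i`
cannot be strongly blocked, since in any blocking attempt some participant gets at most `u i`.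

Such an allocation is obtained by rounding. Averaging the members of `D` with the balancing weights
gives a fractional assignment of objects to slots (agent, category). An object is used by a
coalition only if its owner belongs to it, so its total load is at most one; each slot is filled at
most once, and agent `i` receives at least `u i` on average. Because utilities count satisfied
slots, this is a bipartite fractional matching with quotas, and Hall's theorem makes it integral
(`exists_integral_assignment`).

Scarf's lemma itself is proved by parity. For a generic right-hand side, feasible bases come in
pairs under pivoting (`even_card_supportsSolution`), and dominating families come in pairs under
exchange except at one place (`odd_card_dominates`, `even_card_dominates`). Double counting then
forces a basis that dominates, and a limit reaches the right-hand side `1`. -/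

/-! ### Parity: double counting in place of path following. -/

section Scarf

/-- Two families `F` and `G` of `n`-sets have a common member when every `(n + 1)`-set contains
evenly many members of `F` and every `(n - 1)`-set avoiding `a` lies in evenly many members of
`G`, with the single exception of `N₀.erase a` for one `N₀ ∈ F`. -/
theorem exists_mem_of_even_of_odd {M : Type*} [DecidableEq M] {n : ℕ}
    (F G : Finset (Finset M)) (hFn : ∀ B ∈ F, B.card = n) (hGn : ∀ D ∈ G, D.card = n)
    (a : M) (N₀ : Finset M) (haN : a ∈ N₀) (hN : N₀ ∈ F)
    (hF : ∀ P : Finset M, P.card = n + 1 → Even (F.filter (· ⊆ P)).card)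
    (hodd : Odd (G.filter (N₀.erase a ⊆ ·)).card)
    (heven : ∀ R : Finset M, R.card + 1 = n → a ∉ R → R ≠ N₀.erase a →
      Even (G.filter (R ⊆ ·)).card) :
    ∃ D ∈ F, D ∈ G := by
  by_contra! hFG
  let F' := F.filter (a ∈ ·)
  let G' := G.filter (a ∉ ·)
  let rel : Finset M → Finset M → Prop := fun B D => B.erase a ⊆ D
  have hdc := Finset.sum_card_bipartiteAbove_eq_sum_card_bipartiteBelow (s := F') (t := G') rel
  -- A member of `F` inside `insert a D` must contain `a`: otherwise it would equal `D` and be a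
  -- common member.
  have hright : Even (∑ D ∈ G', (F'.bipartiteBelow rel D).card) := by
    refine Finset.even_sum _ fun D hD => ?_
    obtain ⟨hDG, haD⟩ := Finset.mem_filter.1 hD
    have h := hF (insert a D) (by rw [Finset.card_insert_of_notMem haD, hGn D hDG])
    suffices hE : F'.bipartiteBelow rel D = F.filter (· ⊆ insert a D) by rwa [hE]
    ext B
    simp only [Finset.mem_bipartiteBelow, F', rel, Finset.mem_filter,
      ← Finset.subset_insert_iff]
    constructor
    · rintro ⟨⟨h1, -⟩, h2⟩; exact ⟨h1, h2⟩
    · rintro ⟨h1, h2⟩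
      refine ⟨⟨h1, ?_⟩, h2⟩
      by_contra haB
      have hBD : B ⊆ D := (Finset.subset_insert_iff_of_notMem haB).1 h2
      have : B = D := Finset.eq_of_subset_of_card_le hBD (by rw [hFn B h1, hGn D hDG])
      exact hFG B h1 (this ▸ hDG)
  have habove : ∀ B ∈ F',
      G'.bipartiteAbove rel B = G.filter (B.erase a ⊆ ·) := by
    intro B hB
    obtain ⟨hBF, haB⟩ := Finset.mem_filter.1 hB
    ext D
    simp only [Finset.mem_bipartiteAbove, G', rel, Finset.mem_filter]
    constructor
    · rintro ⟨⟨h1, -⟩, h2⟩; exact ⟨h1, h2⟩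
    · rintro ⟨h1, h2⟩
      refine ⟨⟨h1, fun haD => ?_⟩, h2⟩
      have hBD : B ⊆ D := by
        rw [← Finset.insert_erase haB]; exact Finset.insert_subset haD h2
      have : B = D := Finset.eq_of_subset_of_card_le hBD (by rw [hFn B hBF, hGn D h1])
      exact hFG B hBF (this ▸ h1)
  have hN' : N₀ ∈ F' := Finset.mem_filter.2 ⟨hN, haN⟩
  have hleft : Odd (∑ B ∈ F', (G'.bipartiteAbove rel B).card) := by
    rw [← Finset.add_sum_erase _ _ hN', habove _ hN']
    refine hodd.add_even (Finset.even_sum _ fun B hB => ?_)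
    obtain ⟨hne, hB⟩ := Finset.mem_erase.1 hB
    rw [habove B hB]
    obtain ⟨hBF, haB⟩ := Finset.mem_filter.1 hB
    refine heven _ ?_ (Finset.notMem_erase _ _) fun h => hne ?_
    · rw [Finset.card_erase_add_one haB, hFn B hBF]
    · rw [← Finset.insert_erase haB, h, Finset.insert_erase haN]
  rw [hdc] at hleft
  exact (Nat.not_even_iff_odd.2 hleft) hright

/-- `B` supports a nonnegative solution of `T α = t`. -/
def SupportsSolution {M V : Type*} [AddCommGroup V] [Module ℝ V]
    (T : (M → ℝ) →ₗ[ℝ] V) (t : V) (B : Finset M) : Prop :=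
  ∃ α : M → ℝ, (∀ j, 0 ≤ α j) ∧ (∀ j ∉ B, α j = 0) ∧ T α = t

/-! ### Feasible bases of a nondegenerate linear system. -/

section Linear

variable {M V : Type*} [Fintype M] [DecidableEq M] [AddCommGroup V] [Module ℝ V]
  {T : (M → ℝ) →ₗ[ℝ] V} {t : V} {n : ℕ}

theorem no_solution_of_card_lt
    (hgen : ∀ α, T α = t → n ≤ (Finset.univ.filter (α · ≠ 0)).card)
    {B : Finset M} (hB : B.card < n) {α : M → ℝ} (hα : ∀ j ∉ B, α j = 0) : T α ≠ t := by
  intro h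
  refine absurd ((hgen α h).trans (Finset.card_le_card (t := B) fun j hj => ?_)) hB.not_ge
  by_contra hjB
  exact (Finset.mem_filter.1 hj).2 (hα j hjB)

theorem solution_ne_zero
    (hgen : ∀ α, T α = t → n ≤ (Finset.univ.filter (α · ≠ 0)).card)
    {B : Finset M} (hB : B.card = n) {α : M → ℝ} (hα : ∀ j ∉ B, α j = 0) (h : T α = t)
    {j : M} (hj : j ∈ B) : α j ≠ 0 := by
  intro h0
  refine no_solution_of_card_lt hgen (B := B.erase j) ?_ (fun l hl => ?_) h
  · rw [← hB]; exact Finset.card_erase_lt_of_mem hj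
  · by_cases hlj : l = j
    · rw [hlj, h0]
    · exact hα l fun hl' => hl (Finset.mem_erase.2 ⟨hlj, hl'⟩)

/-- The columns in `B` are independent: otherwise subtracting a multiple of `γ` from `α` would kill
a coordinate in `B`, leaving a solution with too small a support. -/
theorem eq_zero_of_map_eq_zero
    (hgen : ∀ α, T α = t → n ≤ (Finset.univ.filter (α · ≠ 0)).card)
    {B : Finset M} (hB : B.card = n) {α : M → ℝ} (hα : ∀ j ∉ B, α j = 0) (h : T α = t)
    {γ : M → ℝ} (hγ : ∀ j ∉ B, γ j = 0) (h0 : T γ = 0) : γ = 0 := by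
  by_contra hne
  obtain ⟨z, hz⟩ : ∃ z, γ z ≠ 0 := by
    by_contra! hall
    exact hne (funext hall)
  have hzB : z ∈ B := by
    by_contra hzB
    exact hz (hγ z hzB)
  refine solution_ne_zero hgen hB (α := α - (α z / γ z) • γ) ?_ ?_ hzB ?_
  · intro j hj
    simp [hα j hj, hγ j hj]
  · simp [h, h0]
  · simp [div_mul_cancel₀ _ hz]

/-- The simplex pivot. The `n + 1` columns of `P` are dependent; moving from the given solution
along a kernel vector that increases coordinate `x`, some other coordinate decreases, by `hpos`, and
the first to reach zero is `y`. -/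
theorem exists_pivot [FiniteDimensional ℝ V]
    (hgen : ∀ α, T α = t → n ≤ (Finset.univ.filter (α · ≠ 0)).card)
    (hdim : Module.finrank ℝ V ≤ n)
    (hpos : ∀ γ : M → ℝ, (∀ j, 0 ≤ γ j) → T γ = 0 → γ = 0)
    {P : Finset M} (hP : P.card = n + 1) {x : M} (hx : x ∈ P)
    (hfx : SupportsSolution T t (P.erase x)) :
    ∃ y ∈ P, y ≠ x ∧ SupportsSolution T t (P.erase y) := by
  obtain ⟨α, hα0, hαs, hαt⟩ := hfx
  have hcard : (P.erase x).card = n := by rw [Finset.card_erase_of_mem hx, hP]; rfl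
  obtain ⟨γ, hγP, hγx, hγ0⟩ : ∃ γ : M → ℝ, (∀ j ∉ P, γ j = 0) ∧ 0 < γ x ∧ T γ = 0 := by
    let E : (P → ℝ) →ₗ[ℝ] (M → ℝ) := Function.ExtendByZero.linearMap ℝ ((↑) : P → M)
    have hker : LinearMap.ker (T ∘ₗ E) ≠ ⊥ := by
      apply LinearMap.ker_ne_bot_of_finrank_lt
      simp only [Module.finrank_fintype_fun_eq_card, Fintype.card_coe]
      omega
    obtain ⟨g, hg, hg0⟩ := Submodule.exists_mem_ne_zero_of_ne_bot hker
    have hEP : ∀ j ∉ P, E g j = 0 := by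
      intro j hj
      change Function.extend (Subtype.val : P → M) g 0 j = 0
      rw [Function.extend_apply' _ _ _ (by rintro ⟨a, rfl⟩; exact hj a.2)]
      rfl
    have hE0 : E g ≠ 0 := by
      intro h
      apply hg0
      funext j
      have := congrFun h j
      change Function.extend (Subtype.val : P → M) g 0 j = 0 at this
      rwa [Subtype.val_injective.extend_apply] at this
    have hT : T (E g) = 0 := hg
    have hEx : E g x ≠ 0 := by
      intro h
      refine hE0 (eq_zero_of_map_eq_zero hgen hcard hαs hαt (fun j hj => ?_) hT)
      by_cases hjx : j = x
      · rw [hjx, h]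
      · exact hEP j fun hj' => hj (Finset.mem_erase.2 ⟨hjx, hj'⟩)
    rcases hEx.lt_or_gt with h | h
    · exact ⟨-E g, fun j hj => by simp [hEP j hj], by simpa using h, by simp [hT]⟩
    · exact ⟨E g, hEP, h, hT⟩
  have hneg : (P.filter (γ · < 0)).Nonempty := by
    by_contra hemp
    rw [Finset.not_nonempty_iff_eq_empty, Finset.filter_eq_empty_iff] at hemp
    have : γ = 0 := by
      refine hpos γ (fun j => ?_) hγ0
      by_cases hj : j ∈ P
      · exact not_lt.1 (hemp hj)
      · rw [hγP j hj]
    rw [this] at hγx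
    exact lt_irrefl _ hγx
  -- Ratio test: the minimal ratio is the longest step that keeps all coordinates nonnegative.
  obtain ⟨y, hy, hymin⟩ := Finset.exists_min_image _ (fun j => α j / (-γ j)) hneg
  obtain ⟨hyP, hyγ⟩ := Finset.mem_filter.1 hy
  have hs : 0 ≤ α y / (-γ y) := div_nonneg (hα0 y) (by linarith)
  refine ⟨y, hyP, fun h => by rw [h] at hyγ; linarith, α + (α y / (-γ y)) • γ, ?_, ?_, ?_⟩
  · intro j
    simp only [Pi.add_apply, Pi.smul_apply, smul_eq_mul]
    rcases le_or_gt 0 (γ j) with hj | hj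
    · exact add_nonneg (hα0 j) (mul_nonneg hs hj)
    · have hjP : j ∈ P := by
        by_contra hjP
        rw [hγP j hjP] at hj
        exact lt_irrefl _ hj
      have h1 := hymin j (Finset.mem_filter.2 ⟨hjP, hj⟩)
      have h2 : 0 < -γ j := by linarith
      rw [le_div_iff₀ h2] at h1
      linarith
  · intro j hj
    simp only [Pi.add_apply, Pi.smul_apply, smul_eq_mul]
    by_cases hjy : j = y
    · rw [hjy]
      have := div_mul_cancel₀ (α y) (neg_ne_zero.2 hyγ.ne)
      linarith
    · have hjP : j ∉ P := fun h => hj (Finset.mem_erase.2 ⟨hjy, h⟩)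
      rw [hγP j hjP, hαs j fun h => hjP (Finset.mem_of_mem_erase h)]
      ring
  · simp [hαt, hγ0]

/-- The solutions supported in `P` lie on a line, the nonnegative ones form a segment, and each
facet solution is an endpoint; a segment has no third endpoint. -/
theorem not_supportsSolution_of_two
    (hgen : ∀ α, T α = t → n ≤ (Finset.univ.filter (α · ≠ 0)).card)
    {P : Finset M} (hP : P.card = n + 1) {x y z : M} (hx : x ∈ P) (hy : y ∈ P) (hz : z ∈ P)
    (hxy : x ≠ y) (hxz : x ≠ z) (hyz : y ≠ z)
    (hfx : SupportsSolution T t (P.erase x)) (hfy : SupportsSolution T t (P.erase y)) :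
    ¬ SupportsSolution T t (P.erase z) := by
  intro hfz
  obtain ⟨α, hα0, hαs, hαt⟩ := hfx
  obtain ⟨β, hβ0, hβs, hβt⟩ := hfy
  obtain ⟨δ, hδ0, hδs, hδt⟩ := hfz
  have hcard : ∀ w ∈ P, (P.erase w).card = n := fun w hw => by
    rw [Finset.card_erase_of_mem hw, hP]; rfl
  have hαx : α x = 0 := hαs x (Finset.notMem_erase _ _)
  have hβy : β y = 0 := hβs y (Finset.notMem_erase _ _)
  have hδz : δ z = 0 := hδs z (Finset.notMem_erase _ _)
  have pos : ∀ {w : M} {ε : M → ℝ}, w ∈ P → (∀ j, 0 ≤ ε j) → (∀ j ∉ P.erase w, ε j = 0) →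
      T ε = t → ∀ l ∈ P, l ≠ w → 0 < ε l := fun hw h0 hs ht l hl hlw =>
    lt_of_le_of_ne (h0 l)
      (solution_ne_zero hgen (hcard _ hw) hs ht (Finset.mem_erase.2 ⟨hlw, hl⟩)).symm
  have hβx := pos hy hβ0 hβs hβt x hx hxy
  have hδx := pos hz hδ0 hδs hδt x hx hxz
  have hαy := pos hx hα0 hαs hαt y hy hxy.symm
  have hαz := pos hx hα0 hαs hαt z hz hxz.symm
  have hβz := pos hy hβ0 hβs hβt z hz hyz.symm
  have hδy := pos hz hδ0 hδs hδt y hy hyz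
  -- The coefficients cancel coordinate `x`, so independence of the columns in `P.erase x` applies.
  -- Coordinates `y` and `z` then give `β x - δ x` opposite signs.
  have key : δ x • (β - α) - β x • (δ - α) = 0 := by
    refine eq_zero_of_map_eq_zero hgen (hcard x hx) hαs hαt (fun j hj => ?_) ?_
    · by_cases hjx : j = x
      · subst hjx
        simp [hαx]
        ring
      · have hjP : j ∉ P := fun h => hj (Finset.mem_erase.2 ⟨hjx, h⟩)
        have : ∀ w, j ∉ P.erase w := fun w h => hjP (Finset.mem_of_mem_erase h)
        simp [hαs j (this _), hβs j (this _), hδs j (this _)]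
    · simp [hαt, hβt, hδt]
  have ky := congrFun key y
  have kz := congrFun key z
  simp only [Pi.sub_apply, Pi.smul_apply, smul_eq_mul, Pi.zero_apply, hβy, hδz] at ky kz
  have h1 : (β x - δ x) * α y = β x * δ y := by linarith
  have h2 : (β x - δ x) * α z = -(δ x * β z) := by linarith
  have h3 : 0 < (β x - δ x) * α y := h1 ▸ mul_pos hβx hδy
  have h4 : (β x - δ x) * α z < 0 := h2 ▸ neg_lt_zero.2 (mul_pos hδx hβz)
  have h5 := pos_of_mul_pos_left h3 hαy.le
  exact absurd (mul_pos h5 hαz) h4.not_gt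

theorem even_card_supportsSolution [FiniteDimensional ℝ V]
    (hgen : ∀ α, T α = t → n ≤ (Finset.univ.filter (α · ≠ 0)).card)
    (hdim : Module.finrank ℝ V ≤ n)
    (hpos : ∀ γ : M → ℝ, (∀ j, 0 ≤ γ j) → T γ = 0 → γ = 0)
    {P : Finset M} (hP : P.card = n + 1) (F : Finset (Finset M))
    (hF : ∀ B, B ∈ F ↔ B.card = n ∧ SupportsSolution T t B) :
    Even (F.filter (· ⊆ P)).card := by
  rcases (F.filter (· ⊆ P)).eq_empty_or_nonempty with h | ⟨B, hB⟩
  · simp [h]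
  have herase : ∀ B ∈ F.filter (· ⊆ P), ∃ x ∈ P, B = P.erase x := by
    intro B hB
    obtain ⟨hBF, hBP⟩ := Finset.mem_filter.1 hB
    obtain ⟨x, hx⟩ : ∃ x, P \ B = {x} := by
      rw [← Finset.card_eq_one, Finset.card_sdiff_of_subset hBP, ((hF B).1 hBF).1, hP]
      omega
    have hxm : x ∈ P \ B := hx ▸ Finset.mem_singleton_self x
    refine ⟨x, (Finset.mem_sdiff.1 hxm).1, ?_⟩
    rw [Finset.erase_eq, ← hx, Finset.sdiff_sdiff_eq_self hBP]
  have hmem : ∀ x ∈ P, SupportsSolution T t (P.erase x) →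
      P.erase x ∈ F.filter (· ⊆ P) := fun x hx h =>
    Finset.mem_filter.2 ⟨(hF _).2 ⟨by rw [Finset.card_erase_of_mem hx, hP]; rfl, h⟩,
      Finset.erase_subset _ _⟩
  have hsol : ∀ x, P.erase x ∈ F.filter (· ⊆ P) → SupportsSolution T t (P.erase x) :=
    fun x h => ((hF _).1 (Finset.mem_filter.1 h).1).2
  obtain ⟨x, hx, rfl⟩ := herase B hB
  obtain ⟨y, hy, hyx, hfy⟩ := exists_pivot hgen hdim hpos hP hx (hsol x hB)
  suffices h : F.filter (· ⊆ P) = {P.erase x, P.erase y} by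
    rw [h, Finset.card_pair fun h => hyx ((Finset.erase_inj P hx).1 h).symm]
    exact even_two
  ext B
  rw [Finset.mem_insert, Finset.mem_singleton]
  constructor
  · intro hB'
    obtain ⟨z, hz, rfl⟩ := herase B hB'
    by_contra! hne
    refine not_supportsSolution_of_two hgen hP hx hy hz hyx.symm ?_ ?_ (hsol x hB) hfy
      (hsol z hB')
    · rintro rfl; exact hne.1 rfl
    · rintro rfl; exact hne.2 rfl
  · rintro (rfl | rfl)
    exacts [hB, hmem y hy hfy]

end Linear

end Scarf

/-! ### Exchange parity for dominating families. -/

section Ordinal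

/-- For the rankings `r i` of `M`, every `k` is ranked by some `i` at or below all members of
`D`. -/
def Dominates {N M Λ : Type*} [LinearOrder Λ] (r : N → M → Λ) (D : Finset M) : Prop :=
  ∀ k, ∃ i, ∀ d ∈ D, r i k ≤ r i d

variable {N M Λ : Type*} [Fintype N] [DecidableEq N] [Fintype M] [DecidableEq M] [LinearOrder Λ]
  {r : N → M → Λ} {e : N → M}

theorem card_filter_superset_eq {N M Λ : Type*} [DecidableEq M] [LinearOrder Λ] {r : N → M → Λ}
    {n : ℕ} (G : Finset (Finset M))
    (hG : ∀ D, D ∈ G ↔ D.card = n ∧ Dominates r D)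
    {R : Finset M} (hR : R.card + 1 = n) (X : Finset M)
    (hX : ∀ x, x ∈ X ↔ x ∉ R ∧ Dominates r (insert x R)) :
    (G.filter (R ⊆ ·)).card = X.card := by
  symm
  refine Finset.card_bij (fun x _ => insert x R) ?_ ?_ ?_
  · intro x hx
    obtain ⟨hxR, hd⟩ := (hX x).1 hx
    refine Finset.mem_filter.2 ⟨(hG _).2 ⟨?_, hd⟩, Finset.subset_insert _ _⟩
    rw [Finset.card_insert_of_notMem hxR, hR]
  · intro x hx y hy hxy
    exact (Finset.insert_inj ((hX x).1 hx).1).1 hxy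
  · intro D hD
    obtain ⟨hDG, hRD⟩ := Finset.mem_filter.1 hD
    obtain ⟨hDn, hd⟩ := (hG D).1 hDG
    obtain ⟨x, hx⟩ : ∃ x, D \ R = {x} := by
      rw [← Finset.card_eq_one, Finset.card_sdiff_of_subset hRD]
      omega
    have hxm : x ∈ D \ R := hx ▸ Finset.mem_singleton_self x
    have hins : insert x R = D := by
      rw [Finset.insert_eq, ← hx, Finset.sdiff_union_of_subset hRD]
    exact ⟨x, (hX x).2 ⟨(Finset.mem_sdiff.1 hxm).2, hins ▸ hd⟩, hins⟩

/-- The only completion is the element outside `R` ranked highest by `a`: every other agent `i` has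
its bottom element `e i` in `R`, so it can dominate only `e i`. -/
theorem odd_card_dominates (hinj : ∀ i, Function.Injective (r i)) (he : Function.Injective e)
    (hlow : ∀ i k, k ≠ e i → r i (e i) < r i k)
    (hhigh : ∀ i j, j ≠ i → ∀ k ∉ Set.range e, r i k < r i (e j))
    (G : Finset (Finset M)) (hG : ∀ D, D ∈ G ↔ D.card = Fintype.card N ∧ Dominates r D) (a : N) :
    Odd (G.filter ((Finset.univ.image e).erase (e a) ⊆ ·)).card := by
  classical
  set R := (Finset.univ.image e).erase (e a) with hRdef
  have hRmem : ∀ {k}, k ∈ R ↔ ∃ j, j ≠ a ∧ e j = k := by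
    intro k
    simp only [hRdef, Finset.mem_erase, Finset.mem_image, Finset.mem_univ, true_and]
    constructor
    · rintro ⟨h1, j, rfl⟩; exact ⟨j, fun h => h1 (h ▸ rfl), rfl⟩
    · rintro ⟨j, h1, rfl⟩; exact ⟨fun h => h1 (he h), j, rfl⟩
  have haR : e a ∉ R := Finset.notMem_erase _ _
  have hRcard : R.card + 1 = Fintype.card N := by
    rw [hRdef, Finset.card_erase_add_one (Finset.mem_image_of_mem _ (Finset.mem_univ _)),
      Finset.card_image_of_injective _ he, Finset.card_univ]
  obtain ⟨x, hxR, hxmax⟩ := Finset.exists_max_image Rᶜ (r a) ⟨e a, Finset.mem_compl.2 haR⟩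
  rw [Finset.mem_compl] at hxR
  rw [card_filter_superset_eq G hG hRcard {x}]
  · simp
  intro y
  rw [Finset.mem_singleton]
  constructor
  · rintro rfl
    refine ⟨hxR, fun k => ?_⟩
    by_cases hk : k ∈ R
    · obtain ⟨j, -, rfl⟩ := hRmem.1 hk
      refine ⟨j, fun d _ => ?_⟩
      by_cases hd : d = e j
      · rw [hd]
      · exact (hlow j d hd).le
    · refine ⟨a, fun d hd => ?_⟩
      rcases Finset.mem_insert.1 hd with rfl | hd
      · exact hxmax k (Finset.mem_compl.2 hk)
      · obtain ⟨j, hja, rfl⟩ := hRmem.1 hd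
        by_cases hka : k = e a
        · rw [hka]
          exact (hlow a _ fun h => hja (he h)).le
        · refine (hhigh a j hja k ?_).le
          rintro ⟨l, rfl⟩
          exact hk (hRmem.2 ⟨l, fun h => hka (h ▸ rfl), rfl⟩)
  · rintro ⟨hyR, hd⟩
    obtain ⟨i, hi⟩ := hd x
    by_cases hia : i = a
    · subst hia
      exact hinj i (le_antisymm (hxmax y (Finset.mem_compl.2 hyR))
        (hi y (Finset.mem_insert_self _ _)))
    · have hiR : e i ∈ R := hRmem.2 ⟨i, hia, rfl⟩
      have h1 := hi _ (Finset.mem_insert_of_mem hiR)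
      by_cases hx : x = e i
      · exact absurd (hx ▸ hiR) hxR
      · exact absurd (hlow i x hx) h1.not_gt

/-- If a completion exists, every member of `R` is the minimum of `R` in some ranking. As `R` has
one element fewer than `N`, exactly one pair `p`, `q` of rankings shares its minimum. A completion
must become the new minimum of exactly one of these two, and for each of them the best candidate is
the unique choice. -/
theorem even_card_dominates (hinj : ∀ i, Function.Injective (r i)) (he : Function.Injective e)
    (hlow : ∀ i k, k ≠ e i → r i (e i) < r i k)
    (hhigh : ∀ i j, j ≠ i → ∀ k ∉ Set.range e, r i k < r i (e j))
    (G : Finset (Finset M)) (hG : ∀ D, D ∈ G ↔ D.card = Fintype.card N ∧ Dominates r D) (a : N)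
    {R : Finset M} (hR : R.card + 1 = Fintype.card N) (haR : e a ∉ R)
    (hne : R ≠ (Finset.univ.image e).erase (e a)) :
    Even (G.filter (R ⊆ ·)).card := by
  classical
  have hRcard_erase : ∀ i : N, (Finset.univ.erase i).card = R.card := fun i => by
    rw [Finset.card_erase_of_mem (Finset.mem_univ _), Finset.card_univ]
    omega
  have herase_card : ∀ i : N, ((Finset.univ.image e).erase (e i)).card = R.card := fun i => by
    rw [Finset.card_erase_of_mem (Finset.mem_image_of_mem _ (Finset.mem_univ _)),
      Finset.card_image_of_injective _ he, Finset.card_univ]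
    omega
  have hneq : ∀ i, R ≠ (Finset.univ.image e).erase (e i) := by
    intro i h
    by_cases hia : i = a
    · exact hne (hia ▸ h)
    · apply haR
      rw [h, Finset.mem_erase]
      exact ⟨fun h => hia (he h).symm, Finset.mem_image_of_mem _ (Finset.mem_univ _)⟩
  have hRne : R.Nonempty := by
    rw [Finset.nonempty_iff_ne_empty]
    intro h
    refine hne (Finset.eq_of_subset_of_card_le (by simp [h]) (herase_card a).le)
  let X := Finset.univ.filter fun x => x ∉ R ∧ Dominates r (insert x R)
  rw [card_filter_superset_eq G hG hR X (by simp [X])]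
  rcases X.eq_empty_or_nonempty with h | ⟨x₀, hx₀⟩
  · simp [h]
  obtain ⟨hx₀R, hx₀⟩ : x₀ ∉ R ∧ Dominates r (insert x₀ R) := by simpa [X] using hx₀
  choose m hmR hm using fun i => Finset.exists_min_image R (r i) hRne
  have hmeq : ∀ i, ∀ d ∈ R, (∀ d' ∈ R, r i d ≤ r i d') → m i = d := fun i d hd h =>
    hinj i (le_antisymm (hm i d hd) (h _ (hmR i)))
  have hsurj : ∀ d ∈ R, ∃ i, m i = d := fun d hd => by
    obtain ⟨i, hi⟩ := hx₀ d
    exact ⟨i, hmeq i d hd fun d' hd' => hi d' (Finset.mem_insert_of_mem hd')⟩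
  obtain ⟨p, q, hpq, hmpq⟩ : ∃ p q, p ≠ q ∧ m p = m q := by
    obtain ⟨p, -, q, -, hpq, h⟩ := Finset.exists_ne_map_eq_of_card_lt_of_maps_to
      (s := Finset.univ) (t := R) (f := m) (by rw [Finset.card_univ]; omega) fun i _ => hmR i
    exact ⟨p, q, hpq, h⟩
  have hinjOn : ∀ u v, u ≠ v → m u = m v → Set.InjOn m (Finset.univ.erase u : Finset N) := by
    intro u v huv h
    refine Finset.injOn_of_surjOn_of_card_le (t := R) m (fun i _ => hmR i) ?_ (hRcard_erase u).le
    intro d hd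
    obtain ⟨i, rfl⟩ := hsurj d hd
    by_cases hi : i = u
    · exact ⟨v, by simp [huv.symm], by rw [hi, h]⟩
    · exact ⟨i, by simp [hi], rfl⟩
  have hip : ∀ i j, i ≠ p → j ≠ p → m i = m j → i = j := fun i j hi hj h =>
    hinjOn p q hpq hmpq (by simpa using hi) (by simpa using hj) h
  have hiq : ∀ i j, i ≠ q → j ≠ q → m i = m j → i = j := fun i j hi hj h =>
    hinjOn q p hpq.symm hmpq.symm (by simpa using hi) (by simpa using hj) h
  -- the candidates that can become the new minimum in the ranking `i`
  let L : N → Finset M := fun i => Finset.univ.filter fun k => ∀ j, j ≠ i → r j (m j) < r j k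
  have hL : ∀ i k, k ∈ L i ↔ ∀ j, j ≠ i → r j (m j) < r j k := by simp [L]
  have hbelow : ∀ k, ∃ j, r j k ≤ r j (m j) := fun k => by
    obtain ⟨j, hj⟩ := hx₀ k
    exact ⟨j, hj _ (Finset.mem_insert_of_mem (hmR j))⟩
  -- If `e l` with `l ≠ j` were minimal for `j`, then `hlow` and `hhigh` would force `R` to be the
  -- image of `e` without `e j`.
  have hmem_range : ∀ j l, m j = e l → l = j := by
    intro j l h
    by_contra hlj
    refine hneq j (Finset.eq_of_subset_of_card_le (fun d hd => ?_) (herase_card j).le)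
    have hd' := hm j d hd
    rw [h] at hd'
    refine Finset.mem_erase.2 ⟨?_, ?_⟩
    · rintro rfl
      exact absurd (hlow j (e l) fun h => hlj (he h)) hd'.not_gt
    · by_contra hdr
      refine absurd (hhigh j l hlj d ?_) hd'.not_gt
      rintro ⟨i, rfl⟩
      exact hdr (Finset.mem_image_of_mem _ (Finset.mem_univ _))
  have hLne : ∀ i i', i ≠ i' → m i = m i' → (L i).Nonempty := by
    intro i i' hii hmi
    refine ⟨e i, (hL i _).2 fun j hj => ?_⟩
    by_cases hr : m j ∈ Set.range e
    · obtain ⟨l, hl⟩ := hr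
      have := hmem_range j l hl.symm
      rw [← hl, this]
      exact hlow j _ fun h => hj (he h).symm
    · exact hhigh j i hj.symm _ hr
  have hXiff : ∀ x, x ∈ X ↔ ∃ i, (i = p ∨ i = q) ∧ x ∈ L i ∧ ∀ k ∈ L i, r i k ≤ r i x := by
    intro x
    simp only [X, Finset.mem_filter, Finset.mem_univ, true_and]
    constructor
    · rintro ⟨hxR, hx⟩
      obtain ⟨i, hi⟩ := hx x
      have hlt : ∀ d ∈ R, ∃ j, j ≠ i ∧ m j = d ∧ r j d < r j x := by
        intro d hd
        obtain ⟨j, hj⟩ := hx d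
        have hne : d ≠ x := fun h => hxR (h ▸ hd)
        have hlt : r j d < r j x :=
          lt_of_le_of_ne (hj x (Finset.mem_insert_self _ _)) fun h => hne (hinj j h)
        refine ⟨j, ?_, hmeq j d hd fun d' hd' => hj d' (Finset.mem_insert_of_mem hd'), hlt⟩
        rintro rfl
        exact absurd hlt (hi d (Finset.mem_insert_of_mem hd)).not_gt
      have hipq : i = p ∨ i = q := by
        by_contra! h
        obtain ⟨j, hj, hmj, -⟩ := hlt (m i) (hmR i)
        by_cases hjp : j = p
        · exact hj (hiq j i (hjp ▸ hpq) h.2 hmj)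
        · exact hj (hip j i hjp h.1 hmj)
      have hii : ∀ u v, u ≠ i → v ≠ i → m u = m v → u = v := by
        rcases hipq with rfl | rfl
        exacts [hip, hiq]
      refine ⟨i, hipq, (hL i x).2 fun j hj => ?_, fun k hk => ?_⟩
      · obtain ⟨l, hl, hml, hlx⟩ := hlt (m j) (hmR j)
        rwa [hii l j hl hj hml] at hlx
      · obtain ⟨j, hj⟩ := hx k
        by_cases hji : j = i
        · exact hji ▸ hj x (Finset.mem_insert_self _ _)
        · exact absurd ((hL i k).1 hk j hji)
            (hj _ (Finset.mem_insert_of_mem (hmR j))).not_gt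
    · rintro ⟨i, hipq, hxL, hmax⟩
      rw [hL] at hxL
      have hxi : r i x ≤ r i (m i) := by
        obtain ⟨j, hj⟩ := hbelow x
        by_cases hji : j = i
        · exact hji ▸ hj
        · exact absurd (hxL j hji) hj.not_gt
      have hxR : x ∉ R := by
        intro hxR
        obtain ⟨i', hi', hmi⟩ : ∃ i', i' ≠ i ∧ m i' = m i := by
          rcases hipq with rfl | rfl
          exacts [⟨q, hpq.symm, hmpq.symm⟩, ⟨p, hpq, hmpq⟩]
        have hxm : x = m i := hinj i (le_antisymm hxi (hm i x hxR))
        exact absurd (hxL i' hi') (by rw [hmi, hxm]; exact lt_irrefl _)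
      refine ⟨hxR, fun k => ?_⟩
      obtain ⟨j, hjk⟩ := hbelow k
      by_cases hk : k ∈ L i
      · have hji : j = i := by
          by_contra hji
          exact absurd ((hL i k).1 hk j hji) hjk.not_gt
        subst hji
        refine ⟨j, fun d hd => ?_⟩
        rcases Finset.mem_insert.1 hd with rfl | hd
        exacts [hmax k hk, hjk.trans (hm j d hd)]
      · rw [hL] at hk
        push Not at hk
        obtain ⟨l, hli, hl⟩ := hk
        refine ⟨l, fun d hd => ?_⟩
        rcases Finset.mem_insert.1 hd with rfl | hd
        exacts [hl.trans (hxL l hli).le, hl.trans (hm l d hd)]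
  obtain ⟨x, hxL, hx⟩ := Finset.exists_max_image (L p) (r p) (hLne p q hpq hmpq)
  obtain ⟨y, hyL, hy⟩ := Finset.exists_max_image (L q) (r q) (hLne q p hpq.symm hmpq.symm)
  -- An element of both `L p` and `L q` would lie above every minimum, contradicting `hbelow`.
  have hxy : x ≠ y := by
    rintro rfl
    obtain ⟨j, hj⟩ := hbelow x
    by_cases hjp : j = p
    · exact absurd ((hL q x).1 hyL j (hjp ▸ hpq)) hj.not_gt
    · exact absurd ((hL p x).1 hxL j hjp) hj.not_gt
  suffices h : X = {x, y} by
    rw [h, Finset.card_pair hxy]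
    exact even_two
  ext z
  rw [hXiff, Finset.mem_insert, Finset.mem_singleton]
  constructor
  · rintro ⟨i, rfl | rfl, hzL, hz⟩
    · exact .inl (hinj i (le_antisymm (hx z hzL) (hz x hxL)))
    · exact .inr (hinj i (le_antisymm (hy z hzL) (hz y hyL)))
  · rintro (rfl | rfl)
    exacts [⟨p, .inl rfl, hxL, hx⟩, ⟨q, .inr rfl, hyL, hy⟩]

end Ordinal

/-! ### Scarf's lemma for coalitions, by genericity and a limit. -/

section Balanced

variable {N M : Type*} [DecidableEq N] [Fintype M]

/-- The total weight of the coalitions containing each agent, for weights on coalitions. -/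
def coverage (S : M → Finset N) : (M → ℝ) →ₗ[ℝ] (N → ℝ) :=
  LinearMap.pi fun i => ∑ j with i ∈ S j, LinearMap.proj j

theorem coverage_apply (S : M → Finset N) (α : M → ℝ) (i : N) :
    coverage S α i = ∑ j with i ∈ S j, α j := by
  simp [coverage]

theorem le_coverage {S : M → Finset N} {α : M → ℝ} (hα : ∀ j, 0 ≤ α j) {i : N} {j : M}
    (hi : i ∈ S j) : α j ≤ coverage S α i := by
  rw [coverage_apply]
  exact Finset.single_le_sum (f := α) (fun l _ => hα l)
    (Finset.mem_filter.2 ⟨Finset.mem_univ j, hi⟩)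

variable [Fintype N] [DecidableEq M]

/-- For almost every target, a solution of a linear system has at least as many nonzero
coordinates as there are equations. -/
theorem dense_forall_card_le {N M : Type*} [Fintype N] [Fintype M] [DecidableEq M]
    (T : (M → ℝ) →ₗ[ℝ] (N → ℝ)) :
    Dense {t : N → ℝ | ∀ α, T α = t →
      Fintype.card N ≤ (Finset.univ.filter (α · ≠ 0)).card} := by
  apply MeasureTheory.Measure.dense_of_ae (μ := MeasureTheory.volume)
  let W : Finset M → Submodule ℝ (N → ℝ) := fun B =>
    Submodule.span ℝ (B.image fun j => T (Pi.single j 1) : Finset (N → ℝ))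
  have hW : ∀ B : Finset M, B.card < Fintype.card N →
      ∀ᵐ t : N → ℝ, t ∉ W B := by
    intro B hB
    refine MeasureTheory.measure_eq_zero_iff_ae_notMem.1
      (MeasureTheory.Measure.addHaar_submodule _ _ fun h => ?_)
    have h1 := finrank_span_finset_le_card (R := ℝ) (B.image fun j => T (Pi.single j 1))
    change Module.finrank ℝ (W B) ≤ _ at h1
    rw [h, finrank_top, Module.finrank_fintype_fun_eq_card] at h1
    exact absurd (h1.trans Finset.card_image_le) hB.not_ge
  have hall : ∀ᵐ t : N → ℝ, ∀ B : Finset M, B.card < Fintype.card N → t ∉ W B := by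
    rw [MeasureTheory.ae_all_iff]
    intro B
    by_cases hB : B.card < Fintype.card N
    · filter_upwards [hW B hB] with t ht _ using ht
    · exact Filter.Eventually.of_forall fun t h => absurd h hB
  filter_upwards [hall] with t ht α hα
  by_contra! hlt
  refine ht _ hlt ?_
  rw [← hα, LinearMap.pi_apply_eq_sum_univ T α]
  refine Submodule.sum_mem _ fun j _ => ?_
  by_cases hj : α j = 0
  · simp [hj]
  · refine Submodule.smul_mem _ _ (Submodule.subset_span ?_)
    have : (fun i : M => if j = i then (1 : ℝ) else 0) = Pi.single j 1 := by
      funext i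
      simp [Pi.single_apply, eq_comm]
    rw [this]
    exact Finset.mem_coe.2 (Finset.mem_image_of_mem _ (by simp [hj]))

variable {Λ : Type*} [LinearOrder Λ] {S : M → Finset N} {r : N → M → Λ} {e : N → M}

/-- The parity argument starts at the singletons `e i`, which form a feasible basis with weights
`t`. Nonempty coalitions rule out nonzero nonnegative kernel vectors. -/
theorem exists_dominates_of_generic [Nonempty N] (hS : ∀ j, (S j).Nonempty)
    (hSe : ∀ i, S (e i) = {i})
    (hinj : ∀ i, Function.Injective (r i)) (hlow : ∀ i k, k ≠ e i → r i (e i) < r i k)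
    (hhigh : ∀ i j, j ≠ i → ∀ k ∉ Set.range e, r i k < r i (e j))
    {t : N → ℝ} (ht : ∀ i, 0 < t i) (hgen : ∀ α, coverage S α = t →
      Fintype.card N ≤ (Finset.univ.filter (α · ≠ 0)).card) :
    ∃ D : Finset M, Dominates r D ∧ SupportsSolution (coverage S) t D := by
  classical
  have he : Function.Injective e := fun i j h => by
    have := hSe i
    rw [h, hSe j] at this
    exact (Finset.singleton_injective this).symm
  let F : Finset (Finset M) := Finset.univ.filter fun B =>
    B.card = Fintype.card N ∧ SupportsSolution (coverage S) t B
  let G : Finset (Finset M) := Finset.univ.filter fun D =>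
    D.card = Fintype.card N ∧ Dominates r D
  have hF : ∀ B, B ∈ F ↔ B.card = Fintype.card N ∧ SupportsSolution (coverage S) t B := by
    simp [F]
  have hG : ∀ D, D ∈ G ↔ D.card = Fintype.card N ∧ Dominates r D := by simp [G]
  obtain ⟨a⟩ := ‹Nonempty N›
  have hN : Finset.univ.image e ∈ F := by
    refine (hF _).2 ⟨by rw [Finset.card_image_of_injective _ he, Finset.card_univ],
      Function.extend e t 0, fun j => ?_, fun j hj => ?_, ?_⟩
    · by_cases hj : ∃ i, e i = j
      · obtain ⟨i, rfl⟩ := hj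
        rw [he.extend_apply]
        exact (ht i).le
      · rw [Function.extend_apply' _ _ _ hj]
        rfl
    · rw [Function.extend_apply']
      · rfl
      · rintro ⟨i, rfl⟩
        exact hj (Finset.mem_image_of_mem _ (Finset.mem_univ _))
    · funext i
      rw [coverage_apply, Finset.sum_eq_single_of_mem (e i) (by simp [hSe])]
      · rw [he.extend_apply]
      · intro j hj hji
        rw [Function.extend_apply']
        · rfl
        · rintro ⟨l, rfl⟩
          have : i ∈ S (e l) := (Finset.mem_filter.1 hj).2
          rw [hSe, Finset.mem_singleton] at this
          exact hji (this ▸ rfl)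
  have hFeven : ∀ P : Finset M, P.card = Fintype.card N + 1 →
      Even (F.filter (· ⊆ P)).card := by
    intro P hP
    refine even_card_supportsSolution hgen (by simp) (fun γ hγ h0 => ?_) hP F hF
    funext j
    obtain ⟨i, hi⟩ := hS j
    have := le_coverage hγ hi
    rw [h0] at this
    exact le_antisymm this (hγ j)
  obtain ⟨D, hDF, hDG⟩ := exists_mem_of_even_of_odd F G (fun B h => ((hF B).1 h).1)
    (fun D h => ((hG D).1 h).1) (e a) (Finset.univ.image e)
    (Finset.mem_image_of_mem _ (Finset.mem_univ _)) hN hFeven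
    (odd_card_dominates hinj he hlow hhigh G hG a)
    (fun R hR haR hne => even_card_dominates hinj he hlow hhigh G hG a hR haR hne)
  exact ⟨D, ((hG D).1 hDG).2, ((hF D).1 hDF).2⟩

/-- **Scarf's lemma** for families of coalitions: some family `D` of coalitions that dominates
all of them carries balancing weights. -/
theorem exists_dominates_balanced [Nonempty N] (hS : ∀ j, (S j).Nonempty)
    (hSe : ∀ i, S (e i) = {i})
    (hinj : ∀ i, Function.Injective (r i)) (hlow : ∀ i k, k ≠ e i → r i (e i) < r i k)
    (hhigh : ∀ i j, j ≠ i → ∀ k ∉ Set.range e, r i k < r i (e j)) :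
    ∃ D : Finset M, Dominates r D ∧ ∃ α : M → ℝ, (∀ j, 0 ≤ α j) ∧ (∀ j ∉ D, α j = 0) ∧
      ∀ i, ∑ j with i ∈ S j, α j = 1 := by
  classical
  let Z : Finset M → Set (M → ℝ) := fun D =>
    Set.univ.pi fun j => if j ∈ D then Set.Icc 0 2 else {0}
  have hZ : ∀ D, IsCompact (Z D) := fun D => isCompact_univ_pi fun j => by
    split_ifs
    exacts [isCompact_Icc, isCompact_singleton]
  -- Targets below `2` bound all weights by `2`, so `Y` is a finite union of compact sets and
  -- contains the limit target `1`.
  let Y : Set (N → ℝ) := ⋃ D ∈ {D : Finset M | Dominates r D}, coverage S '' Z D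
  have hY : IsClosed Y := Set.Finite.isClosed_biUnion (Set.toFinite _) fun D _ =>
    ((hZ D).image (LinearMap.continuous_of_finiteDimensional _)).isClosed
  let U : Set (N → ℝ) := Set.univ.pi fun _ => Set.Ioo 0 2
  have hU : IsOpen U := isOpen_set_pi Set.finite_univ fun _ _ => isOpen_Ioo
  have hUY : U ∩ {t | ∀ α, coverage S α = t →
      Fintype.card N ≤ (Finset.univ.filter (α · ≠ 0)).card} ⊆ Y := by
    rintro t ⟨htU, htgen⟩
    have htU' : ∀ i, 0 < t i ∧ t i < 2 := fun i => htU i (Set.mem_univ i)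
    obtain ⟨D, hD, α, hα0, hαD, hαt⟩ := exists_dominates_of_generic hS hSe hinj hlow hhigh
      (fun i => (htU' i).1) htgen
    refine Set.mem_iUnion₂.2 ⟨D, hD, α, fun j _ => ?_, hαt⟩
    change α j ∈ if j ∈ D then Set.Icc (0 : ℝ) 2 else {0}
    split_ifs with hj
    · obtain ⟨i, hi⟩ := hS j
      exact ⟨hα0 j, (le_coverage hα0 hi).trans (hαt ▸ (htU' i).2.le)⟩
    · exact hαD j hj
  have h1 : (1 : N → ℝ) ∈ Y := by
    have := (dense_forall_card_le (coverage S)).open_subset_closure_inter hU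
    exact closure_minimal hUY hY (this fun i _ => by simp)
  obtain ⟨D, hD, α, hα, hα1⟩ := Set.mem_iUnion₂.1 h1
  refine ⟨D, hD, α, fun j => ?_, fun j hj => ?_, fun i => ?_⟩
  · have : α j ∈ if j ∈ D then Set.Icc (0 : ℝ) 2 else {0} := hα j (Set.mem_univ j)
    split_ifs at this
    exacts [this.1, (Set.mem_singleton_iff.1 this).ge]
  · have : α j ∈ if j ∈ D then Set.Icc (0 : ℝ) 2 else {0} := hα j (Set.mem_univ j)
    rwa [if_neg hj] at this
  · rw [← coverage_apply, hα1]
    rfl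

/-- Scarf's lemma for levels `c i j` that may tie. -/
theorem exists_balanced_of_levels [Nonempty N] (hS : ∀ j, (S j).Nonempty)
    (hSe : ∀ i, S (e i) = {i}) (c : N → M → ℕ) (hlow : ∀ i k, k ≠ e i → c i (e i) < c i k)
    (hhigh : ∀ i j, j ≠ i → ∀ k ∉ Set.range e, c i k < c i (e j)) :
    ∃ D : Finset M, (∀ k, ∃ i, ∀ d ∈ D, c i k ≤ c i d) ∧
      ∃ α : M → ℝ, (∀ j, 0 ≤ α j) ∧ (∀ j ∉ D, α j = 0) ∧ ∀ i, ∑ j with i ∈ S j, α j = 1 := by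
  classical
  let f := Fintype.equivFin M
  obtain ⟨D, hD, h⟩ := exists_dominates_balanced (S := S) (e := e)
    -- Ties are broken by an arbitrary enumeration of `M`; forgetting it only weakens the
    -- comparisons.
    (r := fun i j => toLex (c i j, f j)) hS hSe
    (fun i j k h => f.injective (congrArg (fun x => (ofLex x).2) h))
    (fun i k hk => Prod.Lex.toLex_lt_toLex.2 (.inl (hlow i k hk)))
    (fun i j hj k hk => Prod.Lex.toLex_lt_toLex.2 (.inl (hhigh i j hj k hk)))
  refine ⟨D, fun k => ?_, h⟩
  obtain ⟨i, hi⟩ := hD k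
  exact ⟨i, fun d hd => (Prod.Lex.toLex_le_toLex.1 (hi d hd)).elim le_of_lt fun h => h.1.le⟩

end Balanced

/-! ### Integral rounding by bipartite matching. -/

/-- A fractional matching that saturates `L` yields a matching that saturates `L`. -/
theorem exists_injective_of_weights {L R : Type*} [Fintype L] [Fintype R] (w : L → R → ℝ)
    (h0 : ∀ l r, 0 ≤ w l r) (hL : ∀ l, 1 ≤ ∑ r, w l r) (hR : ∀ r, ∑ l, w l r ≤ 1) :
    ∃ f : L → R, Function.Injective f ∧ ∀ l, 0 < w l (f l) := by
  classical
  let nb : L → Finset R := fun l => Finset.univ.filter fun r => 0 < w l r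
  obtain ⟨f, hf, hfn⟩ := (Finset.all_card_le_biUnion_card_iff_exists_injective nb).1 fun s => by
    have h : (s.card : ℝ) ≤ (s.biUnion nb).card := by
      calc (s.card : ℝ) = ∑ l ∈ s, (1 : ℝ) := by simp
        _ ≤ ∑ l ∈ s, ∑ r, w l r := Finset.sum_le_sum fun l _ => hL l
        _ = ∑ l ∈ s, ∑ r ∈ s.biUnion nb, w l r := by
          refine Finset.sum_congr rfl fun l hl => (Finset.sum_subset (Finset.subset_univ _) ?_).symm
          intro r _ hr
          by_contra hne
          exact hr (Finset.mem_biUnion.2 ⟨l, hl, Finset.mem_filter.2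
            ⟨Finset.mem_univ _, lt_of_le_of_ne (h0 l r) (Ne.symm hne)⟩⟩)
        _ = ∑ r ∈ s.biUnion nb, ∑ l ∈ s, w l r := Finset.sum_comm
        _ ≤ ∑ r ∈ s.biUnion nb, (1 : ℝ) := Finset.sum_le_sum fun r _ =>
          (Finset.sum_le_univ_sum_of_nonneg fun l => h0 l r).trans (hR r)
        _ = _ := by simp
    exact_mod_cast h
  exact ⟨f, hf, fun l => (Finset.mem_filter.1 (hfn l)).2⟩

/-- Rounding: if fractional amounts `x i k o` give each object to at most one slot `(i, k)`, fill
each slot at most once, and give agent `i` at least `u i` in total, then the objects can be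
assigned to slots, at most one to each, with agent `i` getting at least `u i` of them. -/
theorem exists_integral_assignment {A O : Type*} [Fintype A] [Fintype O] {K : ℕ}
    (x : A → Fin K → O → ℝ) (h0 : ∀ i k o, 0 ≤ x i k o) (hslot : ∀ i k, ∑ o, x i k o ≤ 1)
    (hobj : ∀ o, ∑ i, ∑ k, x i k o ≤ 1) (u : A → ℕ)
    (hu : ∀ i, (u i : ℝ) ≤ ∑ k, ∑ o, x i k o) :
    ∃ g : A → Fin K → Option O, (∀ i k o, g i k = some o → 0 < x i k o) ∧
      (∀ i k i' k' o, g i k = some o → g i' k' = some o → i = i' ∧ k = k') ∧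
      ∀ i, u i ≤ (Finset.univ.filter fun k => (g i k).isSome).card := by
  classical
  have hslack : ∀ i, ∑ k, (1 - ∑ o, x i k o) ≤ (K : ℝ) - u i := fun i => by
    have := hu i
    simp only [Finset.sum_sub_distrib, Finset.sum_const, Finset.card_univ, Fintype.card_fin,
      nsmul_eq_mul, mul_one]
    linarith
  have huK : ∀ i, u i ≤ K := fun i => by
    have h1 : 0 ≤ ∑ k, (1 - ∑ o, x i k o) := Finset.sum_nonneg fun k _ => by
      linarith [hslot i k]
    have h2 : (u i : ℝ) ≤ K := by linarith [hslack i]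
    exact_mod_cast h2
  -- Agent `i` gets `K - u i` private dummies, over which the slack of each of its slots is spread
  -- evenly. Once all slots are matched, at most `K - u i` of them use dummies, so at least `u i`
  -- hold real objects.
  let w : A × Fin K → O ⊕ (Σ i, Fin (K - u i)) → ℝ := fun l => Sum.elim (fun o => x l.1 l.2 o)
    fun d => if l.1 = d.1 then (1 - ∑ o, x l.1 l.2 o) / (K - u l.1 : ℝ) else 0
  have hw0 : ∀ l r, 0 ≤ w l r := by
    rintro ⟨i, k⟩ (o | d)
    · exact h0 i k o
    · simp only [w, Sum.elim_inr]
      split_ifs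
      · have h1 : (u i : ℝ) ≤ K := by exact_mod_cast huK i
        exact div_nonneg (by linarith [hslot i k]) (by simpa using h1)
      · exact le_rfl
  have hwL : ∀ l, 1 ≤ ∑ r, w l r := by
    rintro ⟨i, k⟩
    simp only [w, Fintype.sum_sum_type, Sum.elim_inl, Sum.elim_inr, Fintype.sum_sigma]
    rw [Finset.sum_eq_single_of_mem i (Finset.mem_univ _) (fun j _ hj => by simp [hj.symm])]
    simp only [if_true, Finset.sum_const, Finset.card_univ, Fintype.card_fin, nsmul_eq_mul]
    rw [Nat.cast_sub (huK i)]
    -- With no dummies, the total slack is at most zero, so each slot is already full.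
    by_cases hK : (K : ℝ) - u i = 0
    · have h2 := hslack i
      rw [hK] at h2
      have h3 : 1 - ∑ o, x i k o ≤ ∑ k, (1 - ∑ o, x i k o) :=
        Finset.single_le_sum (f := fun k => 1 - ∑ o, x i k o)
          (fun k _ => by linarith [hslot i k]) (Finset.mem_univ k)
      rw [hK]
      linarith
    · rw [mul_div_cancel₀ _ hK]
      linarith
  have hwR : ∀ r, ∑ l, w l r ≤ 1 := by
    rintro (o | ⟨j, d⟩)
    · simpa [w, Fintype.sum_prod_type] using hobj o
    · simp only [w, Fintype.sum_prod_type, Sum.elim_inr]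
      rw [Finset.sum_eq_single_of_mem j (Finset.mem_univ _) (fun i _ hi => by simp [hi])]
      simp only [if_true]
      rw [← Finset.sum_div]
      have h1 : (u j : ℝ) ≤ K := by exact_mod_cast huK j
      exact div_le_one_of_le₀ (hslack j) (by linarith)
  obtain ⟨f, hf, hfw⟩ := exists_injective_of_weights w hw0 hwL hwR
  have hdummy : ∀ i k d, f (i, k) = Sum.inr d → d.1 = i := by
    intro i k d h
    have := hfw (i, k)
    rw [h] at this
    by_contra hne
    simp [w, Ne.symm hne] at this
  refine ⟨fun i k => (f (i, k)).getLeft?, fun i k o h => ?_, fun i k i' k' o h h' => ?_,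
    fun i => ?_⟩
  · have h := Sum.getLeft?_eq_some_iff.1 h
    simpa [w, h] using hfw (i, k)
  · have h1 := Sum.getLeft?_eq_some_iff.1 h
    have h2 := Sum.getLeft?_eq_some_iff.1 h'
    exact Prod.mk.inj (hf (h1.trans h2.symm))
  · change u i ≤ (Finset.univ.filter fun k => ((f (i, k)).getLeft?).isSome).card
    have hc := Finset.card_filter_add_card_filter_not (s := (Finset.univ : Finset (Fin K)))
      (fun k => ((f (i, k)).getLeft?).isSome)
    have hle : (Finset.univ.filter fun k => ¬ ((f (i, k)).getLeft?).isSome).card ≤ K - u i := by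
      have himg : (Finset.univ.filter fun k => ¬ ((f (i, k)).getLeft?).isSome).image
          (fun k => f (i, k)) ⊆
          (Finset.univ : Finset (Fin (K - u i))).image fun d => Sum.inr ⟨i, d⟩ := by
        intro y hy
        obtain ⟨k, hk, rfl⟩ := Finset.mem_image.1 hy
        have hk := (Finset.mem_filter.1 hk).2
        rcases hfk : f (i, k) with o | ⟨j, d⟩
        · simp [hfk] at hk
        · obtain rfl : j = i := hdummy i k _ hfk
          exact Finset.mem_image_of_mem _ (Finset.mem_univ d)
      have := Finset.card_le_card himg
      rw [Finset.card_image_of_injective _ fun k k' h => (Prod.mk.inj (hf h)).2] at this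
      exact this.trans (Finset.card_image_le.trans (by simp))
    rw [Finset.card_univ, Fintype.card_fin] at hc
    have := huK i
    omega

/-! ### From balanced coalition allocations to one allocation. -/

open Classical in
/-- The number of categories in which the bundle `Z` holds an object of utility `1`. -/
noncomputable def satisfiedCount {O : Type*} [DecidableEq O] {K : ℕ} (C : Fin K → Finset O) (w : Fin K → O → ℝ)
    (Z : Finset O) : ℕ :=
  (Finset.univ.filter fun k => ∃ o ∈ Z ∩ C k, w k o = 1).card

open Classical in
theorem sum_categoryValue {O : Type*} [DecidableEq O] {K : ℕ} (C : Fin K → Finset O) (w : Fin K → O → ℝ)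
    (Z : Finset O) : ∑ k, categoryValue (w k) (Z ∩ C k) = satisfiedCount C w Z := by
  simp only [categoryValue, satisfiedCount, Finset.sum_boole]

theorem satisfiedCount_le {O : Type*} [DecidableEq O] {K : ℕ} (C : Fin K → Finset O) (w : Fin K → O → ℝ)
    (Z : Finset O) : satisfiedCount C w Z ≤ K := by
  exact (Finset.card_filter_le _ _).trans (by simp)

open Classical in
theorem exists_selection {O : Type*} [DecidableEq O] {K : ℕ} (C : Fin K → Finset O) (w : Fin K → O → ℝ)
    (Z : Finset O) : ∃ s : Fin K → Option O, (∀ k o, s k = some o → o ∈ Z ∧ o ∈ C k ∧ w k o = 1) ∧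
      satisfiedCount C w Z = (Finset.univ.filter fun k => (s k).isSome).card := by
  refine ⟨fun k => if h : ∃ o ∈ Z ∩ C k, w k o = 1 then some h.choose else none,
    fun k o h => ?_, ?_⟩
  · dsimp only at h
    split_ifs at h with h'
    obtain rfl := Option.some.inj h
    have := h'.choose_spec
    exact ⟨(Finset.mem_inter.1 this.1).1, (Finset.mem_inter.1 this.1).2, this.2⟩
  · rw [satisfiedCount]
    congr 1
    ext k
    simp only [Finset.mem_filter, Finset.mem_univ, true_and]
    split_ifs with h <;> simpa using h

/-- Balanced weights on coalition allocations can be rounded to one allocation, which takes at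
most one object of each category to each agent and satisfies every agent in at least as many
categories as the worst coalition allocation of positive weight that involves the agent. -/
theorem Economy.exists_allocation_of_balanced {A O : Type*} [Fintype A] [Fintype O]
    [DecidableEq A] [DecidableEq O]
    (E : Economy A O) {K : ℕ} (C : Fin K → Finset O) (w : A → Fin K → O → ℝ)
    (hC : ∀ k l, k ≠ l → Disjoint (C k) (C l)) {M : Type*} [Fintype M]
    (S : M → Finset A) (Y : M → A → Finset O) (hY : ∀ j, E.IsCoalitionAllocation (S j) (Y j))
    (α : M → ℝ) (hα : ∀ j, 0 ≤ α j) (hα1 : ∀ i, ∑ j with i ∈ S j, α j = 1)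
    (u : A → ℕ) (hu : ∀ i j, i ∈ S j → α j ≠ 0 → u i ≤ satisfiedCount C (w i) (Y j i)) :
    ∃ X : A → Finset O, E.IsAllocation X ∧ (∀ i k, (X i ∩ C k).card ≤ 1) ∧
      ∀ i, u i ≤ satisfiedCount C (w i) (X i) := by
  classical
  choose s hs hscount using fun j i => exists_selection C (w i) (Y j i)
  let x : A → Fin K → O → ℝ := fun i k o =>
    ∑ j with i ∈ S j, if s j i k = some o then α j else 0
  have hxsum : ∀ i k, ∑ o, x i k o = ∑ j with i ∈ S j, if (s j i k).isSome then α j else 0 := by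
    intro i k
    simp only [x]
    rw [Finset.sum_comm]
    refine Finset.sum_congr rfl fun j _ => ?_
    rcases h : s j i k with _ | o
    · simp
    · simp
  obtain ⟨g, hg, hginj, hgu⟩ := exists_integral_assignment x
    (fun i k o => Finset.sum_nonneg fun j _ => by split_ifs <;> simp [hα])
    (fun i k => by
      rw [hxsum, ← hα1 i]
      exact Finset.sum_le_sum fun j _ => by split_ifs <;> simp [hα])
    (fun o => by
      -- A coalition allocation uses `o` in at most one slot, and only if the owner `a` belongs to
      -- the coalition; the weights of the coalitions containing `a` sum to one.
      obtain ⟨a, ha⟩ := E.ω_cover o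
      calc ∑ i, ∑ k, x i k o
          = ∑ j, ∑ i, ∑ k, if i ∈ S j ∧ s j i k = some o then α j else 0 := by
            rw [Finset.sum_comm (s := (Finset.univ : Finset M))]
            refine Finset.sum_congr rfl fun i _ => ?_
            rw [Finset.sum_comm (s := (Finset.univ : Finset M))]
            refine Finset.sum_congr rfl fun k _ => ?_
            simp only [x, Finset.sum_filter, ite_and]
        _ ≤ ∑ j, if a ∈ S j then α j else 0 := by
            refine Finset.sum_le_sum fun j _ => ?_
            by_cases h : ∃ i k, i ∈ S j ∧ s j i k = some o
            · obtain ⟨i, k, hi, hk⟩ := h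
              have ho := hs j i k o hk
              have haS : a ∈ S j := by
                obtain ⟨b, hb, hob⟩ := Finset.mem_biUnion.1
                  ((hY j).2 (Finset.mem_biUnion.2 ⟨i, hi, ho.1⟩))
                by_contra haS
                exact Finset.disjoint_left.1
                  (E.ω_disjoint a b fun h => haS (h ▸ hb)) ha hob
              rw [if_pos haS, Finset.sum_eq_single_of_mem i (Finset.mem_univ _),
                Finset.sum_eq_single_of_mem k (Finset.mem_univ _)]
              · simp [hi, hk]
              · intro l _ hl
                rw [if_neg]
                rintro ⟨-, h⟩
                exact Finset.disjoint_left.1 (hC l k hl) (hs j i l o h).2.1 ho.2.1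
              · intro i' _ hi'
                refine Finset.sum_eq_zero fun l _ => if_neg ?_
                rintro ⟨h1, h⟩
                exact Finset.disjoint_left.1 ((hY j).1 i' h1 i hi hi') (hs j i' l o h).1 ho.1
            · push Not at h
              rw [Finset.sum_eq_zero fun i _ => Finset.sum_eq_zero fun k _ =>
                if_neg fun h' => h i k h'.1 h'.2]
              split_ifs <;> simp [hα]
        _ = 1 := by rw [← hα1 a, Finset.sum_filter])
    u (fun i => by
      calc (u i : ℝ) = ∑ j with i ∈ S j, α j * u i := by
            rw [← Finset.sum_mul, hα1, one_mul]
        _ ≤ ∑ j with i ∈ S j, α j * satisfiedCount C (w i) (Y j i) := by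
            refine Finset.sum_le_sum fun j hj => ?_
            by_cases h0 : α j = 0
            · simp [h0]
            · refine mul_le_mul_of_nonneg_left ?_ (hα j)
              exact_mod_cast hu i j (Finset.mem_filter.1 hj).2 h0
        _ = ∑ k, ∑ o, x i k o := by
            simp only [hxsum]
            rw [Finset.sum_comm]
            refine Finset.sum_congr rfl fun j _ => ?_
            rw [hscount, ← Finset.sum_filter, Finset.sum_const, nsmul_eq_mul, mul_comm])
  have hgs : ∀ i k o, g i k = some o → o ∈ C k ∧ w i k o = 1 := by
    intro i k o h
    obtain ⟨j, -, hj⟩ := Finset.exists_ne_zero_of_sum_ne_zero (hg i k o h).ne'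
    by_cases h' : s j i k = some o
    · exact (hs j i k o h').2
    · simp [h'] at hj
  let X : A → Finset O := fun i => Finset.univ.filter fun o => ∃ k, g i k = some o
  have hX : ∀ i o, o ∈ X i ↔ ∃ k, g i k = some o := by simp [X]
  refine ⟨X, fun i j hij => ?_, fun i k => ?_, fun i => ?_⟩
  · refine Finset.disjoint_left.2 fun o ho ho' => ?_
    obtain ⟨k, hk⟩ := (hX i o).1 ho
    obtain ⟨l, hl⟩ := (hX j o).1 ho'
    exact hij (hginj i k j l o hk hl).1
  · have hgk : ∀ o ∈ X i ∩ C k, g i k = some o := by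
      intro o ho
      obtain ⟨hoX, hoC⟩ := Finset.mem_inter.1 ho
      obtain ⟨l, hl⟩ := (hX i o).1 hoX
      by_cases hlk : l = k
      · rwa [← hlk]
      · exact absurd hoC (Finset.disjoint_left.1 (hC l k hlk) (hgs i l o hl).1)
    refine Finset.card_le_one.2 fun o ho o' ho' => Option.some.inj ?_
    rw [← hgk o ho, ← hgk o' ho']
  · refine (hgu i).trans (Finset.card_le_card fun k hk => ?_)
    obtain ⟨o, ho⟩ := Option.isSome_iff_exists.1 (Finset.mem_filter.1 hk).2
    exact Finset.mem_filter.2 ⟨Finset.mem_univ _, o,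
      Finset.mem_inter.2 ⟨(hX i o).2 ⟨k, ho⟩, (hgs i k o ho).1⟩, (hgs i k o ho).2⟩

/-! ### Unblocked allocations in categorical economies. -/

/-- A categorical economy has a nonempty weak core. -/
theorem theorem2 {A O : Type*} [Fintype A] [Fintype O] [DecidableEq O]
    (E : Economy A O) (hE : E.IsCategorical) : E.weakCore.Nonempty := by
  classical
  rcases isEmpty_or_nonempty A with hA | hA
  · exact ⟨fun _ => ∅, fun i => hA.elim i, fun S hS => hA.elim hS.choose⟩
  obtain ⟨K, C, w, hC, -, hv⟩ := hE
  let Q := {q : Finset A × (A → Finset O) // q.1.Nonempty ∧ E.IsCoalitionAllocation q.1 q.2}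
  let S : A ⊕ Q → Finset A := Sum.elim (fun i => {i}) fun q => q.1.1
  let Y : A ⊕ Q → A → Finset O := Sum.elim (fun _ _ => ∅) fun q => q.1.2
  have hY : ∀ j, E.IsCoalitionAllocation (S j) (Y j) := by
    rintro (i | q)
    · exact ⟨fun _ _ _ _ _ => Finset.disjoint_empty_left _, by simp [Y]⟩
    · exact q.2.2
  let y : A → A ⊕ Q → ℕ := fun i j => satisfiedCount C (w i) (Y j i)
  -- For agent `i`, its own singleton `.inl i` is at the bottom, coalitions with `i` take levels `1`
  -- to `K + 1`, those without `i` level `K + 2`, and the singletons `.inl j` of others come on top,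
  -- as Scarf's lemma requires.
  let c : A → A ⊕ Q → ℕ := fun i => Sum.elim (fun j => if j = i then 0 else K + 3)
    fun q => if i ∈ q.1.1 then y i (.inr q) + 1 else K + 2
  have hyK : ∀ i j, y i j ≤ K := fun i j => satisfiedCount_le _ _ _
  obtain ⟨D, hD, α, hα, hαD, hα1⟩ := exists_balanced_of_levels (S := S) (e := Sum.inl)
    (by rintro (i | q); exacts [Finset.singleton_nonempty i, q.2.1]) (fun i => rfl) c
    (by
      rintro i (j | q) h
      · have : j ≠ i := fun h' => h (h' ▸ rfl)
        simp [c, this]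
      · simp only [c, Sum.elim_inl, Sum.elim_inr, if_true]
        split_ifs <;> omega)
    (by
      rintro i j hj (k | q) h
      · exact absurd ⟨k, rfl⟩ h
      · have := hyK i (.inr q)
        simp only [c, Sum.elim_inl, Sum.elim_inr, if_neg hj]
        split_ifs <;> omega)
  have hDne : ∀ i, (D.filter (i ∈ S ·)).Nonempty := by
    intro i
    have h1 := hα1 i
    obtain ⟨j, hj, hj0⟩ := Finset.exists_ne_zero_of_sum_ne_zero (h1 ▸ one_ne_zero)
    refine ⟨j, Finset.mem_filter.2 ⟨?_, (Finset.mem_filter.1 hj).2⟩⟩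
    by_contra hjD
    exact hj0 (hαD j hjD)
  choose d hd hdmin using fun i => Finset.exists_min_image _ (y i) (hDne i)
  obtain ⟨X, hX, hX1, hXu⟩ := E.exists_allocation_of_balanced C w hC S Y hY α hα hα1
    (fun i => y i (d i)) fun i j hi hj => hdmin i j <| Finset.mem_filter.2
      ⟨by by_contra hjD; exact hj (hαD j hjD), hi⟩
  refine ⟨X, hX, ?_⟩
  rintro T hT ⟨Z, hZ, hTZ⟩
  -- The agent `i` dominating the blocking pair must belong to `T`, since `d i` involves `i` and so
  -- has level at most `K + 1`. Then `Z i` satisfies no more categories than `d i` does, hence no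
  -- more than `X i`.
  obtain ⟨i, hi⟩ := hD (.inr ⟨(T, Z), hT, hZ⟩)
  obtain ⟨hdD, hdS⟩ := Finset.mem_filter.1 (hd i)
  have hle := hi (d i) hdD
  rcases hdi : d i with j | q
  · rw [hdi] at hdS hle
    have hij : j = i := (Finset.mem_singleton.1 hdS).symm
    simp only [c, Sum.elim_inl, Sum.elim_inr, if_pos hij] at hle
    split_ifs at hle <;> omega
  · have hiq : i ∈ q.1.1 := by rw [hdi] at hdS; exact hdS
    have hyq := hyK i (.inr q)
    rw [hdi] at hle
    simp only [c, Sum.elim_inr, if_pos hiq] at hle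
    split_ifs at hle with hiT
    · have hlt := hTZ i hiT
      have hEX : E.v i (X i) = ((satisfiedCount C (w i) (X i) : ℝ) : WithBot ℝ) := by
        rw [(hv i (X i)).1 (hX1 i), sum_categoryValue]
      have hEZ : E.v i (Z i) = ((satisfiedCount C (w i) (Z i) : ℝ) : WithBot ℝ) := by
        rw [← sum_categoryValue]
        by_cases h : ∀ k, (Z i ∩ C k).card ≤ 1
        · exact (hv i (Z i)).1 h
        · push Not at h
          -- A strictly preferred bundle cannot have utility `⊥`.
          exact ((hv i (Z i)).2 h).resolve_right (ne_bot_of_gt hlt)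
      rw [hEX, hEZ, WithBot.coe_lt_coe, Nat.cast_lt] at hlt
      have h1 := hXu i
      simp only [hdi] at h1
      change satisfiedCount C (w i) (Z i) + 1 ≤ y i (.inr q) + 1 at hle
      omega
    · omega
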